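/- Consider a collocated network with one full-duplex access point, $N_F\ge 0$ full-duplex (FD) users and $N_H\ge 0$ half-duplex (HD) users, and let $\mathcal E$ be the set of its $2(N_F+N_H)$ links: an uplink $(i,\mathrm u)$ and a downlink $(i,\mathrm d)$ for every user $i$. A schedule is a vector $X\in\{0,1\}^{\mathcal E}$; the set $\mathcal S$ of feasible schedules consists of $0$, the unit vectors $e_l$ $(l\in\mathcal E)$, and the vectors $e_{(i,\mathrm u)}+e_{(i,\mathrm d)}$ for FD users $i$. The capacity region is the convex hull $\Lambda=\mathrm{Co}(\mathcal S)\subset\mathbb R^{\mathcal E}$. If $Q(t)\in\mathbb Z_{\ge0}^{\mathcal E}$ are the queue lengths at the beginning of slot $t$, $A(t)\in\mathbb Z_{\ge0}^{\mathcal E}$ the arrivals and $X(t)$ the schedule in slot $t$, then $Q(t+1)=[Q(t)+A(t)-X(t)]^+$ componentwise. Greedy Maximal Scheduling (GMS) selects, in each slot $t$, a link $l^\star$ with the largest queue length $Q_l(t)$, breaking ties uniformly at random. If $l^\star$ is the uplink or the downlink of an FD user $i$, it activates both links of $i$, $X(t)=e_{(i,\mathrm u)}+e_{(i,\mathrm d)}$;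 if $l^\star$ belongs to an HD user, it activates $l^\star$ only, $X(t)=e_{l^\star}$. (Without users, $X(t)=0$.) A scheduling policy, that is, a rule that draws $X(t)$ at random from a law that depends on $Q(t)$, is called throughput-optimal if it uses only feasible schedules and, for every $\lambda\in\mathrm{int}(\Lambda)$, it keeps the queues stable in the following sense. (a) If the vectors $A(0),A(1),\dots$ are i.i.d. with mean $\lambda$ (with any joint law over the links, and independent of the random choices of the policy), then the Markov chain $Q(t)$ is positive recurrent: from every initial state it reaches, in finite expected time, the set of those states whose expected return time is finite. (b) For every arrival process $A$, possibly dependent over slots and links, with $\lim_{T\to\infty}\frac1T\sum_{t<T}A_l(t)=\lambda_l$ almost surely for all $l\in\mathcal E$, and every random initial state $Q(0)$, the queues are rate stable: $\lim_{T\to\infty}Q_l(T)/T=0$ almost surely for all $l\in\mathcal E$. Here the conditional law of $X(t)$, given $Q(0)$ and all arrivals and schedules of the slots before $t$, is the one that the policy prescribes for $Q(t)$. Proposition. For all $N_F,N_H\ge 0$, GMS is throughput-optimal in the collocated heterogeneous network with $N_F$ FD users and $N_H$ HD users. -/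

import Mathlib

open MeasureTheory Filter Topology
open scoped ENNReal

universe u

namespace HDFD

/-! ### The collocated heterogeneous HD-FD network -/

/-- Users: `NF` full-duplex users (`Sum.inl`) and `NH` half-duplex users (`Sum.inr`). -/
abbrev User (NF NH : ℕ) : Type := Fin NF ⊕ Fin NH

/-- Direction of a link: uplink or downlink. -/
inductive Dir : Type
  | ul
  | dl
  deriving DecidableEq

instance : Fintype Dir := ⟨{Dir.ul, Dir.dl}, fun d => by cases d <;> simp⟩

/-- The `2 (NF + NH)` links: an uplink and a downlink between the access point and every user. -/
abbrev Link (NF NH : ℕ) : Type := User NF NH × Dir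

/-- A schedule, given as the set of links that are active in the slot. -/
abbrev Schedule (NF NH : ℕ) : Type := Finset (Link NF NH)

/-- A vector of queue lengths. -/
abbrev Queues (NF NH : ℕ) : Type := Link NF NH → ℕ

/-- Feasible schedules of the collocated network: idle, a single link, or the uplink/downlink
pair of one full-duplex user. -/
inductive Feasible {NF NH : ℕ} : Schedule NF NH → Prop
  | idle : Feasible ∅
  | single (l : Link NF NH) : Feasible {l}
  | pair (i : Fin NF) : Feasible {(Sum.inl i, Dir.ul), (Sum.inl i, Dir.dl)}

/-- The 0/1 vector of a schedule. -/
def schedVec {NF NH : ℕ} (X : Schedule NF NH) : Link NF NH → ℝ :=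
  fun l => if l ∈ X then 1 else 0

/-- The capacity region: the convex hull of the feasible schedules. -/
def capacityRegion (NF NH : ℕ) : Set (Link NF NH → ℝ) :=
  convexHull ℝ {v | ∃ X : Schedule NF NH, Feasible X ∧ v = schedVec X}

/-- Queue update in one slot: `[q + a - X]⁺` on every link (truncated subtraction on `ℕ`). -/
def nextQueues {NF NH : ℕ} (q a : Queues NF NH) (X : Schedule NF NH) : Queues NF NH :=
  fun l => q l + a l - (if l ∈ X then 1 else 0)

/-! ### Scheduling policies and Greedy Maximal Scheduling -/

/-- A randomized scheduling policy: the law of the schedule as a function of the queue lengths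
at the beginning of the slot. -/
abbrev Policy (NF NH : ℕ) : Type := Queues NF NH → PMF (Schedule NF NH)

/-- The links with the largest queue length. -/
def longest {NF NH : ℕ} (q : Queues NF NH) : Finset (Link NF NH) :=
  Finset.univ.filter fun l => ∀ l', q l' ≤ q l

/-- The schedule used by GMS once the link `l` is selected: both links of the user if the user is
full-duplex, and only `l` if the user is half-duplex. -/
def activate {NF NH : ℕ} : Link NF NH → Schedule NF NH
  | (Sum.inl i, _) => {(Sum.inl i, Dir.ul), (Sum.inl i, Dir.dl)}
  | (Sum.inr i, j) => {(Sum.inr i, j)}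

/-- Greedy Maximal Scheduling: select a link with the largest queue, ties being broken uniformly
at random, and activate it (together with its companion link for a full-duplex user).
The second branch only concerns the network without users. -/
noncomputable def gms (NF NH : ℕ) : Policy NF NH := fun q =>
  if h : (longest q).Nonempty then (PMF.uniformOfFinset (longest q) h).map activate
  else PMF.pure ∅

/-! ### Positive recurrence of Markov chains on a countable state space -/

/-- For the chain with transition law `P` started at `x`, and `T = inf {n ≥ 1 | chain in B}` at
time `n`, this is the probability that `T > n`. -/
noncomputable def hitTail {S : Type*} (P : S → PMF S) (B : Set S) : ℕ → S → ℝ≥0∞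
  | 0, _ => 1
  | n + 1, x => ∑' y, P x y * Bᶜ.indicator (hitTail P B n) y

/-- The expectation `∑ n, ℙ (T > n)` of the first time `T ≥ 1` at which the chain started at `x`
is in `B`. -/
noncomputable def meanHit {S : Type*} (P : S → PMF S) (B : Set S) (x : S) : ℝ≥0∞ :=
  ∑' n, hitTail P B n x

/-- The states with a finite mean return time. -/
def posRecStates {S : Type*} (P : S → PMF S) : Set S :=
  {y | meanHit P {y} y < ∞}

/-- Positive recurrence of a chain on a state space that may also hold transient states (as queue
lengths that the given arrivals never produce again): from every initial state the chain reaches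
the positive recurrent states in finite mean time. -/
def PositiveRecurrent {S : Type*} (P : S → PMF S) : Prop :=
  ∀ x, meanHit P (posRecStates P) x < ∞

/-- The queue-length Markov chain of the policy `π` when the vectors of arrivals of the slots are
independent with common law `ν`. -/
noncomputable def queueChain {NF NH : ℕ} (π : Policy NF NH) (ν : PMF (Queues NF NH))
    (q : Queues NF NH) : PMF (Queues NF NH) :=
  (π q).bind fun X => ν.map fun a => nextQueues q a X

/-! ### Queue processes with general arrivals -/

/-- `Q` is the queue process driven by the arrivals `A` and by schedules `X` that are drawn
according to the policy `π`; `ℱ t` is the information at the beginning of slot `t`. The arrivals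
may be dependent over slots and over links. -/
structure IsRun {NF NH : ℕ} (π : Policy NF NH) {Ω : Type u} {m : MeasurableSpace Ω}
    (μ : Measure Ω) (ℱ : Filtration ℕ m) (A : ℕ → Ω → Queues NF NH)
    (X : ℕ → Ω → Schedule NF NH) (Q : ℕ → Ω → Queues NF NH) : Prop where
  initial : ∀ l, Measurable[ℱ 0] fun ω => Q 0 ω l
  arrivals : ∀ t l, Measurable[ℱ (t + 1)] fun ω => A t ω l
  schedules : ∀ t x, MeasurableSet[ℱ (t + 1)] {ω | X t ω = x}
  law : ∀ t x B, MeasurableSet[ℱ t] B →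
    μ (B ∩ {ω | X t ω = x}) = ∫⁻ ω in B, π (Q t ω) x ∂μ
  step : ∀ t ω, Q (t + 1) ω = nextQueues (Q t ω) (A t ω) (X t ω)

/-- The arrival process has long-term rate `lam`, almost surely. -/
def HasRate {NF NH : ℕ} {Ω : Type u} {_ : MeasurableSpace Ω} (μ : Measure Ω)
    (A : ℕ → Ω → Queues NF NH) (lam : Link NF NH → ℝ) : Prop :=
  ∀ᵐ ω ∂μ, ∀ l, Tendsto (fun T : ℕ => (∑ t ∈ Finset.range T, (A t ω l : ℝ)) / T) atTop
    (𝓝 (lam l))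

/-- Rate stability: almost surely, every queue length is `o(T)`. -/
def RateStable {NF NH : ℕ} {Ω : Type u} {_ : MeasurableSpace Ω} (μ : Measure Ω)
    (Q : ℕ → Ω → Queues NF NH) : Prop :=
  ∀ᵐ ω ∂μ, ∀ l, Tendsto (fun T : ℕ => (Q T ω l : ℝ) / T) atTop (𝓝 0)

/-- Throughput optimality: the policy only uses feasible schedules, and for every arrival rate
vector in the interior of the capacity region it stabilizes the queues. Stability means that
* the queue-length Markov chain is positive recurrent, when the arrival vectors of the slots are
  i.i.d. with mean `lam` (arbitrary joint law over the links);
* the queues are rate stable, for all arrival processes of long-term rate `lam`. -/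
def ThroughputOptimal {NF NH : ℕ} (π : Policy NF NH) : Prop :=
  (∀ q, ∀ X ∈ (π q).support, Feasible X) ∧
  ∀ lam ∈ interior (capacityRegion NF NH),
    (∀ ν : PMF (Queues NF NH),
      (∀ l, ∑' a, ν a * (a l : ℝ≥0∞) = ENNReal.ofReal (lam l)) →
      PositiveRecurrent (queueChain π ν)) ∧
    (∀ (Ω : Type u) (m : MeasurableSpace Ω) (μ : Measure Ω) (_ : IsProbabilityMeasure μ)
      (ℱ : Filtration ℕ m) (A : ℕ → Ω → Queues NF NH) (X : ℕ → Ω → Schedule NF NH)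
      (Q : ℕ → Ω → Queues NF NH),
      IsRun π μ ℱ A X Q → HasRate μ A lam → RateStable μ Q)

end HDFD

/-! Call two links equivalent when they are activated together: the two links of an FD user form a
group, each HD link is a group of its own. A feasible schedule is active in at most one group, so
for any choice of one link per group the chosen rates sum to at most one on the capacity region, and
to less than one in its interior. Choosing a fastest link of each group gives group rates with `∑ ρ
< 1`. GMS serves in each slot the whole group of some longest queue, and nothing else about it is
used. The natural Lyapunov function is therefore the sum over the groups of their longest queues.

For i.i.d. arrivals that function is too rough: where queues tie, its mean growth is governed by the
mean of a maximum of arrivals, not by the maximum of the means. So each maximum is replaced by `θ⁻¹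
log ∑ exp (θ q)`. Its gradient is a probability vector on the group, so arrivals raise the sum by at
most `∑ ρ` on average, up to an error that vanishes as `θ → 0` under a first moment alone. Service
lowers it by one, up to a term that is small once the longest queue is long. Foster's criterion
gives finite mean hitting times of a finite set, and `meanHit_lt_top_of_insert` strips that set of
the states that are not positive recurrent; no irreducibility is needed.

Rate stability is a pathwise statement (`tendsto_queue_div`). Service is wasted on an empty queue
only while a companion in its group is a longest queue; during a period of large workload that
companion is long, so the linear bound for it carries over to the wasted queue (`queue_le_of_busy`).
Summed over the groups, arrivals at total rate at most one meet one service per slot, and the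
workload can grow only by `o(T)`. -/

namespace HDFD

/-! ### Hitting times and positive recurrence of countable chains -/

section Markov

variable {S : Type*} (P : S → PMF S)

/-- One step of the chain, killed on entering `B`. -/
noncomputable def killedStep (B : Set S) (f : S → ℝ≥0∞) (x : S) : ℝ≥0∞ :=
  ∑' y, P x y * Bᶜ.indicator f y

/-- The expectation of `T ∧ N`, for the first time `T ≥ 1` in `B`. -/
noncomputable def partialHit (B : Set S) (N : ℕ) (x : S) : ℝ≥0∞ :=
  ∑ n ∈ Finset.range N, hitTail P B n x

lemma hitTail_succ (B : Set S) (n : ℕ) : hitTail P B (n + 1) = killedStep P B (hitTail P B n) := rfl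

lemma killedStep_mono {B : Set S} {f g : S → ℝ≥0∞} (h : ∀ y ∉ B, f y ≤ g y) (x : S) :
    killedStep P B f x ≤ killedStep P B g x := by
  refine ENNReal.tsum_le_tsum fun y => ?_
  refine mul_le_mul_right ?_ _
  by_cases hy : y ∈ B <;> simp [hy, h]

lemma killedStep_add (B : Set S) (f g : S → ℝ≥0∞) (x : S) :
    killedStep P B (fun y => f y + g y) x = killedStep P B f x + killedStep P B g x := by
  simp only [killedStep, ← ENNReal.tsum_add, ← mul_add]
  refine tsum_congr fun y => ?_
  by_cases hy : y ∈ B <;> simp [hy]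

lemma killedStep_const_mul (B : Set S) (c : ℝ≥0∞) (f : S → ℝ≥0∞) (x : S) :
    killedStep P B (fun y => c * f y) x = c * killedStep P B f x := by
  simp only [killedStep, ← ENNReal.tsum_mul_left]
  congr! 2 with y
  by_cases hy : y ∈ B <;> simp [hy, mul_left_comm]

lemma killedStep_finsetSum {ι : Type*} (B : Set S) (s : Finset ι) (f : ι → S → ℝ≥0∞) (x : S) :
    killedStep P B (fun y => ∑ i ∈ s, f i y) x = ∑ i ∈ s, killedStep P B (f i) x := by
  classical
  induction s using Finset.induction_on with
  | empty => simp [killedStep]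
  | insert i s hi ih => simp only [Finset.sum_insert hi, killedStep_add, ih]

lemma killedStep_le (B : Set S) (f : S → ℝ≥0∞) (x : S) :
    killedStep P B f x ≤ ∑' y, P x y * f y := by
  refine ENNReal.tsum_le_tsum fun y => ?_
  gcongr
  exact Set.indicator_le_self _ _ _

lemma hitTail_le_one (B : Set S) (n : ℕ) (x : S) : hitTail P B n x ≤ 1 := by
  induction n generalizing x with
  | zero => simp [hitTail]
  | succ n ih =>
    rw [hitTail_succ]
    calc _ ≤ ∑' y, P x y * hitTail P B n y := killedStep_le ..
      _ ≤ ∑' y, P x y * 1 := ENNReal.tsum_le_tsum fun y => by gcongr; exact ih y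
      _ = 1 := by simp [PMF.tsum_coe]

lemma hitTail_anti {A B : Set S} (h : A ⊆ B) (n : ℕ) (x : S) :
    hitTail P B n x ≤ hitTail P A n x := by
  induction n generalizing x with
  | zero => simp [hitTail]
  | succ n ih =>
    refine ENNReal.tsum_le_tsum fun y => ?_
    gcongr
    by_cases hy : y ∈ B
    · simp [hy]
    · have hA : y ∉ A := fun h' => hy (h h')
      simp [hy, hA, ih]

lemma meanHit_anti {A B : Set S} (h : A ⊆ B) (x : S) : meanHit P B x ≤ meanHit P A x :=
  ENNReal.tsum_le_tsum fun n => hitTail_anti P h n x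

/-- The union bound for the hitting times of `A` and `B`. -/
lemma hitTail_add_le (A B : Set S) (n : ℕ) (x : S) :
    hitTail P A n x + hitTail P B n x ≤ hitTail P (A ∪ B) n x + 1 := by
  induction n generalizing x with
  | zero => simp [hitTail]
  | succ n ih =>
    calc _ = ∑' y, P x y * (Aᶜ.indicator (hitTail P A n) y + Bᶜ.indicator (hitTail P B n) y) := by
          simp only [mul_add, ENNReal.tsum_add, hitTail]
      _ ≤ ∑' y, P x y * ((A ∪ B)ᶜ.indicator (hitTail P (A ∪ B) n) y + 1) := by
          refine ENNReal.tsum_le_tsum fun y => ?_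
          refine mul_le_mul_right ?_ _
          by_cases hA : y ∈ A <;> by_cases hB : y ∈ B <;> simp [hA, hB, ih, hitTail_le_one]
      _ = _ := by simp only [mul_add, ENNReal.tsum_add, hitTail, mul_one, PMF.tsum_coe]

lemma partialHit_succ (B : Set S) (N : ℕ) (x : S) :
    partialHit P B (N + 1) x = 1 + killedStep P B (partialHit P B N) x := by
  rw [partialHit, Finset.sum_range_succ', add_comm]
  have : partialHit P B N = fun y => ∑ n ∈ Finset.range N, hitTail P B n y := rfl
  rw [this, killedStep_finsetSum]
  simp only [hitTail_succ]
  rfl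

lemma partialHit_mono (B : Set S) (x : S) : Monotone fun N => partialHit P B N x :=
  fun _ _ h => Finset.sum_le_sum_of_subset (Finset.range_mono h)

lemma partialHit_le_meanHit (B : Set S) (N : ℕ) (x : S) : partialHit P B N x ≤ meanHit P B x :=
  ENNReal.sum_le_tsum _

lemma partialHit_le (B : Set S) (N : ℕ) (x : S) : partialHit P B N x ≤ N := by
  calc _ ≤ ∑ n ∈ Finset.range N, (1 : ℝ≥0∞) :=
        Finset.sum_le_sum fun n _ => hitTail_le_one P B n x
    _ = N := by simp

lemma meanHit_le_of_partialHit_le {B : Set S} {x : S} {c : ℝ≥0∞}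
    (h : ∀ N, partialHit P B N x ≤ c) : meanHit P B x ≤ c := by
  rw [meanHit, ENNReal.tsum_eq_iSup_nat]
  exact iSup_le h

lemma meanHit_eq (B : Set S) (x : S) : meanHit P B x = 1 + killedStep P B (meanHit P B) x := by
  rw [meanHit, tsum_eq_zero_add' ENNReal.summable]
  simp only [hitTail_succ]
  simp only [hitTail, killedStep]
  rw [ENNReal.tsum_comm]
  congr! 3 with y
  rw [ENNReal.tsum_mul_left]
  by_cases hy : y ∈ B <;> simp [hy, meanHit]

/-- Foster's criterion: a drift condition outside `C` makes the mean hitting times of `C` finite. -/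
theorem meanHit_lt_top_of_drift {C : Set S} {V : S → ℝ≥0∞} {η : ℝ≥0∞} (hη : η ≠ 0)
    (hη' : η ≠ ∞) (hfin : ∀ x, ∑' y, P x y * V y ≠ ∞)
    (hdrift : ∀ x ∉ C, ∑' y, P x y * V y + η ≤ V x) (x : S) : meanHit P C x < ∞ := by
  -- Outside `C` the drift pays `η` for every step. From a point of `C` one uncontrolled step is
  -- taken first, which is why finiteness of the mean of `V` after one step is required everywhere.
  have step (N : ℕ) (hN : ∀ y ∉ C, η * partialHit P C N y ≤ V y) (x : S) :
      η * partialHit P C (N + 1) x ≤ η + ∑' y, P x y * V y := by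
    rw [partialHit_succ, mul_add, mul_one, ← killedStep_const_mul]
    gcongr
    exact (killedStep_mono P hN x).trans (killedStep_le ..)
  have key (N : ℕ) : ∀ y ∉ C, η * partialHit P C N y ≤ V y := by
    induction N with
    | zero => simp [partialHit]
    | succ N ih =>
      exact fun y hy => (step N ih y).trans (by rw [add_comm]; exact hdrift y hy)
  have hb : meanHit P C x ≤ (η + ∑' y, P x y * V y) / η := by
    refine meanHit_le_of_partialHit_le P fun N => ?_
    rw [ENNReal.le_div_iff_mul_le (.inl hη) (.inl hη'), mul_comm]
    refine le_trans ?_ (step N (key N) x)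
    gcongr
    exact partialHit_mono P C x N.le_succ
  exact hb.trans_lt (ENNReal.div_lt_top (ENNReal.add_ne_top.2 ⟨hη', hfin x⟩) hη)

/-- Before it is in `D`, the chain is in `insert y D`, and then it starts again at `y` at worst. -/
lemma partialHit_le_add (D : Set S) (y : S) (N : ℕ) (x : S) :
    partialHit P D N x ≤ meanHit P (insert y D) x + partialHit P D N y := by
  induction N generalizing x with
  | zero => simp [partialHit]
  | succ N ih =>
    rw [partialHit_succ P D N x, meanHit_eq, add_assoc]
    gcongr
    calc killedStep P D (partialHit P D N) x
        ≤ ∑' z, (P x z * (insert y D)ᶜ.indicator (meanHit P (insert y D)) z +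
            P x z * partialHit P D N y) := by
          refine ENNReal.tsum_le_tsum fun z => ?_
          rw [← mul_add]
          gcongr
          by_cases hz : z ∈ D
          · simp [hz]
          · by_cases hzy : z = y
            · subst hzy; simp [hz]
            · simp [hz, hzy, ih]
      _ = killedStep P (insert y D) (meanHit P (insert y D)) x + partialHit P D N y := by
          rw [ENNReal.tsum_add, ENNReal.tsum_mul_right, PMF.tsum_coe, one_mul]; rfl
      _ ≤ _ := by gcongr; exact partialHit_mono P D y N.le_succ

/-- Killing in `D` instead of `insert y D` only adds the paths that step to `y`, and these cost at
most the mean time from `y`. -/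
lemma killedStep_meanHit_insert_le (D : Set S) (y : S) (x : S) :
    killedStep P D (meanHit P (insert y D)) x ≤
      meanHit P (insert y D) x + meanHit P (insert y D) y := by
  calc killedStep P D (meanHit P (insert y D)) x
      ≤ ∑' z, (P x z * (insert y D)ᶜ.indicator (meanHit P (insert y D)) z +
            P x z * meanHit P (insert y D) y) := by
        refine ENNReal.tsum_le_tsum fun z => ?_
        rw [← mul_add]
        gcongr
        by_cases hz : z ∈ D
        · simp [hz]
        · by_cases hzy : z = y
          · subst hzy; simp [hz]
          · simp [hz, hzy]
    _ = killedStep P (insert y D) (meanHit P (insert y D)) x + meanHit P (insert y D) y := by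
        rw [ENNReal.tsum_add, ENNReal.tsum_mul_right, PMF.tsum_coe, one_mul]; rfl
    _ ≤ _ := by
        gcongr
        conv_rhs => rw [meanHit_eq]
        exact le_add_self

/-- The first `k` slots cost at most one each; after them the count resumes from the current state,
unless `D` has been hit. -/
lemma partialHit_add (D : Set S) (N k : ℕ) (x : S) :
    partialHit P D (N + k) x ≤ k + ((killedStep P D)^[k] (partialHit P D N)) x := by
  induction k generalizing x with
  | zero => simp
  | succ k ih =>
    rw [← add_assoc, partialHit_succ, Function.iterate_succ_apply', Nat.cast_succ,
      add_comm (k : ℝ≥0∞), add_assoc]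
    gcongr
    calc _ ≤ killedStep P D (fun z => k * 1 + ((killedStep P D)^[k] (partialHit P D N)) z) x :=
          killedStep_mono P (fun z _ => by simpa using ih z) x
      _ ≤ _ := by
        rw [killedStep_add, killedStep_const_mul]
        gcongr
        refine (mul_le_mul_right (hitTail_le_one P D 1 x) _).trans (by simp)

lemma iterate_killedStep_mono {D : Set S} {f g : S → ℝ≥0∞} (h : ∀ x, f x ≤ g x) (k : ℕ) (x : S) :
    ((killedStep P D)^[k] f) x ≤ ((killedStep P D)^[k] g) x := by
  induction k generalizing x with
  | zero => exact h x
  | succ k ih =>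
    simp only [Function.iterate_succ_apply']
    exact killedStep_mono P (fun z _ => ih z) x

lemma iterate_killedStep_add_const (D : Set S) (f : S → ℝ≥0∞) (c : ℝ≥0∞) (k : ℕ) (x : S) :
    ((killedStep P D)^[k] fun z => f z + c) x =
      ((killedStep P D)^[k] f) x + c * hitTail P D k x := by
  induction k generalizing x with
  | zero => simp [hitTail]
  | succ k ih =>
    simp only [Function.iterate_succ_apply', hitTail_succ]
    rw [← killedStep_const_mul, ← killedStep_add]
    congr! 2 with z
    exact ih z

lemma iterate_killedStep_meanHit_le (D : Set S) (y : S) (k : ℕ) (x : S) :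
    ((killedStep P D)^[k] (meanHit P (insert y D))) x ≤
      meanHit P (insert y D) x + k * meanHit P (insert y D) y := by
  induction k generalizing x with
  | zero => simp
  | succ k ih =>
    simp only [Function.iterate_succ_apply']
    calc _ ≤ killedStep P D
            (fun z => meanHit P (insert y D) z + (k * meanHit P (insert y D) y) * 1) x :=
          killedStep_mono P (fun z _ => by simpa using ih z) x
      _ ≤ (meanHit P (insert y D) x + meanHit P (insert y D) y) +
            k * meanHit P (insert y D) y * 1 := by
          rw [killedStep_add, killedStep_const_mul]
          gcongr
          · exact killedStep_meanHit_insert_le P D y x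
          · exact hitTail_le_one P D 1 x
      _ = _ := by push_cast; ring

/-- A state without finite mean return time can be removed from a set that the chain reaches in
finite mean time. -/
theorem meanHit_lt_top_of_insert {D : Set S} {y : S} (h : ∀ x, meanHit P (insert y D) x < ∞)
    (hy : y ∉ posRecStates P) (x : S) : meanHit P D x < ∞ := by
  suffices hD : meanHit P D y < ∞ by
    refine lt_of_le_of_lt (b := meanHit P (insert y D) x + meanHit P D y) ?_
      (ENNReal.add_lt_top.2 ⟨h x, hD⟩)
    refine meanHit_le_of_partialHit_le P fun N => (partialHit_le_add P D y N x).trans ?_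
    gcongr
    exact partialHit_le_meanHit P D N y
  -- If the chain from `y` almost surely never hit `D`, its hitting time of `insert y D` would be
  -- its return time to `y`, whose mean would then be finite.
  obtain ⟨k, hk⟩ : ∃ k, hitTail P D k y < 1 := by
    by_contra! hc
    refine hy (lt_of_le_of_lt (ENNReal.tsum_le_tsum fun n => ?_) (h y))
    have h1 := hitTail_add_le P {y} D n y
    rw [le_antisymm (hitTail_le_one P D n y) (hc n), Set.singleton_union] at h1
    exact (ENNReal.add_le_add_iff_right ENNReal.one_ne_top).1 h1
  -- Renewal argument: `c` bounds the first `k` steps and the ensuing way to `insert y D`; a restart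
  -- at `y` is needed with probability at most `hitTail P D k y < 1`.
  set c : ℝ≥0∞ := k + (meanHit P (insert y D) y + k * meanHit P (insert y D) y) with hc
  have hct : c ≠ ∞ := by
    have := (h y).ne
    simp [hc, ENNReal.add_eq_top, ENNReal.mul_eq_top, this]
  have hp : 1 - hitTail P D k y ≠ 0 := (tsub_pos_of_lt hk).ne'
  have hb (N : ℕ) : partialHit P D N y ≤ c / (1 - hitTail P D k y) := by
    -- The truncated mean is finite, so it may be moved to the other side of the inequality; the
    -- resulting bound is uniform in `N`.
    have hN : partialHit P D N y ≠ ∞ :=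
      ((partialHit_le P D N y).trans_lt (ENNReal.natCast_lt_top N)).ne
    have h1 : partialHit P D N y ≤ c + partialHit P D N y * hitTail P D k y := by
      calc partialHit P D N y ≤ partialHit P D (N + k) y :=
            partialHit_mono P D y (Nat.le_add_right N k)
        _ ≤ k + ((killedStep P D)^[k] (partialHit P D N)) y := partialHit_add P D N k y
        _ ≤ k + ((killedStep P D)^[k]
              fun z => meanHit P (insert y D) z + partialHit P D N y) y := by
            gcongr
            exact iterate_killedStep_mono P (partialHit_le_add P D y N) k y
        _ ≤ _ := by
            rw [iterate_killedStep_add_const, ← add_assoc, hc]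
            gcongr
            exact iterate_killedStep_meanHit_le P D y k y
    rw [ENNReal.le_div_iff_mul_le (.inl hp) (.inr hct), ENNReal.mul_sub (fun _ _ => hN), mul_one]
    exact tsub_le_iff_right.2 h1
  exact (meanHit_le_of_partialHit_le P hb).trans_lt (ENNReal.div_lt_top hct hp)

/-- A chain that reaches a finite set in finite mean time is positive recurrent. -/
theorem positiveRecurrent_of_finite {C : Set S} (hC : C.Finite)
    (h : ∀ x, meanHit P C x < ∞) : PositiveRecurrent P := by
  induction hn : C.ncard generalizing C with
  | zero =>
    rw [Set.ncard_eq_zero hC] at hn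
    exact fun x => (meanHit_anti P (hn ▸ Set.empty_subset _) x).trans_lt (h x)
  | succ n ih =>
    by_cases hsub : C ⊆ posRecStates P
    · exact fun x => (meanHit_anti P hsub x).trans_lt (h x)
    · obtain ⟨y, hyC, hy⟩ := Set.not_subset.1 hsub
      refine ih (C := C \ {y}) (hC.subset Set.sdiff_subset) ?_ ?_
      · refine meanHit_lt_top_of_insert P (y := y) ?_ hy
        rwa [Set.insert_sdiff_self_of_mem hyC]
      · rw [Set.ncard_sdiff_singleton_of_mem hyC, hn, Nat.add_sub_cancel]

end Markov
-- Means under discrete laws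
lemma tsum_bind_mul {α β : Type*} (p : PMF α) (f : α → PMF β) (W : β → ℝ≥0∞) :
    ∑' y, (p.bind f) y * W y = ∑' x, p x * ∑' y, f x y * W y := by
  simp only [PMF.bind_apply, ← ENNReal.tsum_mul_right, ← ENNReal.tsum_mul_left]
  rw [ENNReal.tsum_comm]
  simp only [mul_assoc]

lemma tsum_map_mul {α β : Type*} (p : PMF α) (f : α → β) (W : β → ℝ≥0∞) :
    ∑' y, (p.map f) y * W y = ∑' x, p x * W (f x) := by
  classical
  rw [PMF.map, tsum_bind_mul]
  refine tsum_congr fun x => ?_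
  rw [tsum_eq_single (f x) fun y hy => by simp [hy]]
  simp

lemma tsum_mul_le {α : Type*} (p : PMF α) {f : α → ℝ≥0∞} {c : ℝ≥0∞}
    (h : ∀ x ∈ p.support, f x ≤ c) : ∑' x, p x * f x ≤ c := by
  calc ∑' x, p x * f x ≤ ∑' x, p x * c := by
        refine ENNReal.tsum_le_tsum fun x => ?_
        by_cases hx : p x = 0
        · simp [hx]
        · exact mul_le_mul_right (h x ((PMF.mem_support_iff p x).2 hx)) _
    _ = c := by rw [ENNReal.tsum_mul_right, PMF.tsum_coe, one_mul]

/-- If `f` has finite mean, then the mean of `min (f, θ f²)` vanishes as `θ → 0`. -/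
lemma tendsto_tsum_min {α : Type*} (p : PMF α) {f : α → ℝ} (hf : ∀ x, 0 ≤ f x)
    (hmean : ∑' x, p x * ENNReal.ofReal (f x) ≠ ∞) :
    Tendsto (fun θ : ℝ => ∑' x, p x * ENNReal.ofReal (min (f x) (θ * f x ^ 2))) (𝓝[>] 0)
      (𝓝 0) := by
  have hsum : Summable fun x => (p x).toReal * f x := by
    have := ENNReal.summable_toReal hmean
    simpa [ENNReal.toReal_mul, ENNReal.toReal_ofReal (hf _)] using this
  have hlim : Tendsto (fun θ : ℝ => ∑' x, (p x).toReal * min (f x) (θ * f x ^ 2)) (𝓝[>] 0)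
      (𝓝 (∑' _ : α, (0 : ℝ))) := by
    -- The summable `p x * f x` dominates, so no second moment is needed.
    refine tendsto_tsum_of_dominated_convergence hsum (fun x => ?_) ?_
    · have hc : Continuous fun θ : ℝ => (p x).toReal * min (f x) (θ * f x ^ 2) := by fun_prop
      have := (hc.tendsto 0).mono_left (nhdsWithin_le_nhds (s := Set.Ioi 0))
      simpa [hf x] using this
    · filter_upwards [self_mem_nhdsWithin] with θ hθ x
      have hθ : (0 : ℝ) < θ := hθ
      have h0 : 0 ≤ min (f x) (θ * f x ^ 2) := le_min (hf x) (by positivity)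
      rw [Real.norm_of_nonneg (by positivity)]
      gcongr
      exact min_le_left _ _
  rw [tsum_zero] at hlim
  have hlim' := ENNReal.tendsto_ofReal hlim
  rw [ENNReal.ofReal_zero] at hlim'
  refine hlim'.congr' ?_
  filter_upwards [self_mem_nhdsWithin] with θ hθ
  have hθ : (0 : ℝ) < θ := hθ
  have h0 (x : α) : 0 ≤ min (f x) (θ * f x ^ 2) := le_min (hf x) (by positivity)
  rw [ENNReal.ofReal_tsum_of_nonneg (fun x => by have := h0 x; positivity)]
  · refine tsum_congr fun x => ?_
    rw [ENNReal.ofReal_mul ENNReal.toReal_nonneg, ENNReal.ofReal_toReal (p.apply_ne_top x)]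
  · refine hsum.of_nonneg_of_le (fun x => by have := h0 x; positivity) fun x => ?_
    gcongr
    exact min_le_left _ _

/-! ### Smoothed workload and its drift -/

section Lyapunov

variable {L G : Type*} [Fintype L] [DecidableEq G] (grp : L → G)

/-- The exponential sum over the queues of the group `g`. -/
noncomputable def expSum (θ : ℝ) (q : L → ℕ) (g : G) : ℝ :=
  ∑ l with grp l = g, Real.exp (θ * q l)

/-- The sum over the groups of the smoothed maxima `θ⁻¹ log ∑ exp (θ q)` of their queues. -/
noncomputable def softWorkload [Fintype G] (θ : ℝ) (q : L → ℕ) : ℝ :=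
  ∑ g, θ⁻¹ * Real.log (expSum grp θ q g)

/-- The share of the queue `l` in the exponential sum of its group. -/
noncomputable def softWeight (θ : ℝ) (q : L → ℕ) (l : L) : ℝ :=
  Real.exp (θ * q l) / expSum grp θ q (grp l)

variable {grp} {θ : ℝ}

lemma exp_le_expSum (θ : ℝ) (q : L → ℕ) (l : L) :
    Real.exp (θ * q l) ≤ expSum grp θ q (grp l) :=
  Finset.single_le_sum (f := fun l => Real.exp (θ * q l)) (fun _ _ => (Real.exp_pos _).le)
    (by simp)

lemma expSum_pos (hgrp : Function.Surjective grp) (θ : ℝ) (q : L → ℕ) (g : G) :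
    0 < expSum grp θ q g := by
  obtain ⟨l, rfl⟩ := hgrp g
  exact (Real.exp_pos _).trans_le (exp_le_expSum θ q l)

lemma softWeight_nonneg (hgrp : Function.Surjective grp) (θ : ℝ) (q : L → ℕ) (l : L) :
    0 ≤ softWeight grp θ q l :=
  div_nonneg (Real.exp_pos _).le (expSum_pos hgrp ..).le

lemma sum_softWeight_mul (hgrp : Function.Surjective grp) (θ : ℝ) (q : L → ℕ) (g : G)
    (f : L → ℝ) : expSum grp θ q g * ∑ l with grp l = g, softWeight grp θ q l * f l =
      ∑ l with grp l = g, Real.exp (θ * q l) * f l := by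
  rw [Finset.mul_sum]
  refine Finset.sum_congr rfl fun l hl => ?_
  obtain rfl : grp l = g := by simpa using hl
  have := (expSum_pos hgrp θ q (grp l)).ne'
  rw [softWeight]
  field_simp

lemma sum_softWeight (hgrp : Function.Surjective grp) (θ : ℝ) (q : L → ℕ) (g : G) :
    ∑ l with grp l = g, softWeight grp θ q l = 1 := by
  have h := sum_softWeight_mul hgrp θ q g 1
  simp only [Pi.one_apply, mul_one] at h
  exact mul_left_cancel₀ (expSum_pos hgrp θ q g).ne' (by rw [h, mul_one]; rfl)

lemma expSum_mono (hθ : 0 ≤ θ) {q q' : L → ℕ} (h : ∀ l, q l ≤ q' l) (g : G) :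
    expSum grp θ q g ≤ expSum grp θ q' g := by
  unfold expSum
  gcongr with l
  exact h l

lemma expSum_add_le_exp_mul (hθ : 0 ≤ θ) (q a : L → ℕ) (g : G) :
    expSum grp θ (fun l => q l + a l) g ≤
      Real.exp (θ * ∑ l, (a l : ℝ)) * expSum grp θ q g := by
  rw [expSum, expSum, Finset.mul_sum]
  refine Finset.sum_le_sum fun l _ => ?_
  rw [← Real.exp_add]
  have : (a l : ℝ) ≤ ∑ l, (a l : ℝ) :=
    Finset.single_le_sum (f := fun l => (a l : ℝ)) (fun _ _ => by positivity) (Finset.mem_univ l)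
  gcongr
  push_cast
  nlinarith

/-- Small arrivals: `exp x ≤ 1 + x + x ^ 2` on `[0, 1]`, averaged with the soft weights, then `1 + y
≤ exp y`. -/
lemma expSum_add_le_mul (hgrp : Function.Surjective grp) (hθ : 0 ≤ θ) (q a : L → ℕ) (g : G)
    (ha : θ * ∑ l, (a l : ℝ) ≤ 1) :
    expSum grp θ (fun l => q l + a l) g ≤ Real.exp (∑ l with grp l = g,
      softWeight grp θ q l * (θ * a l) + (θ * ∑ l, (a l : ℝ)) ^ 2) * expSum grp θ q g := by
  set x := θ * ∑ l, (a l : ℝ)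
  have hexp (l : L) : Real.exp (θ * a l) ≤ θ * a l + (x ^ 2 + 1) := by
    have h1 : (a l : ℝ) ≤ ∑ l, (a l : ℝ) :=
      Finset.single_le_sum (f := fun l => (a l : ℝ)) (fun _ _ => by positivity)
        (Finset.mem_univ l)
    have h2 : θ * a l ≤ x := mul_le_mul_of_nonneg_left h1 hθ
    have h3 : 0 ≤ θ * a l := by positivity
    have h4 := (abs_le.1 (Real.abs_exp_sub_one_sub_id_le
      (x := θ * a l) (by rw [abs_of_nonneg h3]; linarith))).2
    nlinarith
  calc expSum grp θ (fun l => q l + a l) g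
      ≤ ∑ l with grp l = g, Real.exp (θ * q l) * (θ * a l + (x ^ 2 + 1)) := by
        refine Finset.sum_le_sum fun l _ => ?_
        push_cast
        rw [mul_add, Real.exp_add]
        gcongr
        exact hexp l
    _ = (∑ l with grp l = g, softWeight grp θ q l * (θ * a l) + x ^ 2 + 1) *
          expSum grp θ q g := by
        rw [← sum_softWeight_mul hgrp]
        simp only [mul_add, Finset.sum_add_distrib, ← Finset.sum_mul, sum_softWeight hgrp]
        ring
    _ ≤ _ := by
        gcongr
        · exact (expSum_pos hgrp ..).le
        · exact Real.add_one_le_exp _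

/-- The quadratic error serves when `θ ∑ a ≤ 1`, the crude linear one otherwise; linear growth for
large arrivals is what makes a first moment suffice. -/
lemma log_expSum_add_le (hgrp : Function.Surjective grp) (hθ : 0 ≤ θ) (q a : L → ℕ) (g : G) :
    Real.log (expSum grp θ (fun l => q l + a l) g) ≤ Real.log (expSum grp θ q g) +
      (∑ l with grp l = g, softWeight grp θ q l * (θ * a l) +
        min (θ * ∑ l, (a l : ℝ)) ((θ * ∑ l, (a l : ℝ)) ^ 2)) := by
  have hS := expSum_pos hgrp θ q g
  have hS' := expSum_pos hgrp θ (fun l => q l + a l) g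
  set x := θ * ∑ l, (a l : ℝ) with hx
  have hw : 0 ≤ ∑ l with grp l = g, softWeight grp θ q l * (θ * a l) :=
    Finset.sum_nonneg fun l _ => mul_nonneg (softWeight_nonneg hgrp ..) (by positivity)
  have hlog {y : ℝ} (h : expSum grp θ (fun l => q l + a l) g ≤ Real.exp y * expSum grp θ q g) :
      Real.log (expSum grp θ (fun l => q l + a l) g) ≤ Real.log (expSum grp θ q g) + y := by
    calc _ ≤ Real.log (Real.exp y * expSum grp θ q g) := Real.log_le_log hS' h
      _ = _ := by rw [Real.log_mul (Real.exp_pos y).ne' hS.ne', Real.log_exp, add_comm]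
  rcases le_or_gt x 1 with h | h
  · have h0 : 0 ≤ x := by positivity
    rw [min_eq_right (by nlinarith)]
    exact hlog (expSum_add_le_mul hgrp hθ q a g h)
  · rw [min_eq_left (by nlinarith)]
    have := hlog (expSum_add_le_exp_mul hθ q a g)
    linarith

/-- Service multiplies each term of the group by `exp (-θ)`, except that an empty queue keeps its
term `1`. There are at most `card L` such terms, negligible against `exp (θ * q l₀)`, which is
itself part of the sum. -/
lemma log_expSum_served_le (hgrp : Function.Surjective grp) {q q' : L → ℕ} (l₀ : L)
    (h : ∀ l, grp l = grp l₀ → q' l = q l - 1) :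
    Real.log (expSum grp θ q' (grp l₀)) ≤ Real.log (expSum grp θ q (grp l₀)) - θ +
      Fintype.card L * Real.exp θ * Real.exp (-(θ * q l₀)) := by
  have hS := expSum_pos hgrp θ q (grp l₀)
  set y := Fintype.card L * Real.exp θ * Real.exp (-(θ * q l₀)) with hy
  suffices hle : expSum grp θ q' (grp l₀) ≤ Real.exp (y - θ) * expSum grp θ q (grp l₀) by
    calc _ ≤ Real.log (Real.exp (y - θ) * expSum grp θ q (grp l₀)) :=
          Real.log_le_log (expSum_pos hgrp ..) hle
      _ = _ := by rw [Real.log_mul (Real.exp_pos _).ne' hS.ne', Real.log_exp]; ring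
  calc expSum grp θ q' (grp l₀)
      ≤ ∑ l with grp l = grp l₀, (Real.exp (-θ) * Real.exp (θ * q l) + 1) := by
        refine Finset.sum_le_sum fun l hl => ?_
        rw [h l (by simpa using hl), ← Real.exp_add]
        rcases Nat.eq_zero_or_pos (q l) with h0 | h0
        · simp only [h0, Nat.zero_sub, Nat.cast_zero, mul_zero, Real.exp_zero]
          linarith [Real.exp_pos (-θ + 0)]
        · rw [Nat.cast_sub h0]
          have : θ * ((q l : ℝ) - (1 : ℕ)) = -θ + θ * q l := by push_cast; ring
          rw [this]
          linarith
    _ ≤ Real.exp (-θ) * expSum grp θ q (grp l₀) + Fintype.card L := by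
        rw [Finset.sum_add_distrib, ← Finset.mul_sum]
        gcongr
        · exact le_rfl
        · simp only [Finset.sum_const, nsmul_eq_mul, mul_one]
          exact_mod_cast Finset.card_le_univ _
    _ ≤ Real.exp (-θ) * expSum grp θ q (grp l₀) +
          Real.exp (-θ) * (y * expSum grp θ q (grp l₀)) := by
        gcongr
        have h1 := exp_le_expSum (grp := grp) θ q l₀
        calc (Fintype.card L : ℝ)
            = Real.exp (-θ) * (y * Real.exp (θ * q l₀)) := by
              rw [hy, Real.exp_neg, Real.exp_neg]
              have := (Real.exp_pos θ).ne'
              have := (Real.exp_pos (θ * q l₀)).ne'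
              field_simp
          _ ≤ _ := by gcongr
    _ = Real.exp (-θ) * (y + 1) * expSum grp θ q (grp l₀) := by ring
    _ ≤ _ := by
        rw [sub_eq_neg_add, Real.exp_add]
        gcongr
        exact Real.add_one_le_exp y

variable [Fintype G]

lemma softWorkload_nonneg (hgrp : Function.Surjective grp) (hθ : 0 ≤ θ) (q : L → ℕ) :
    0 ≤ softWorkload grp θ q := by
  refine Finset.sum_nonneg fun g _ => mul_nonneg (by positivity) (Real.log_nonneg ?_)
  obtain ⟨l, rfl⟩ := hgrp g
  exact (Real.one_le_exp (by positivity)).trans (exp_le_expSum θ q l)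

lemma softWorkload_mono (hgrp : Function.Surjective grp) (hθ : 0 ≤ θ) {q q' : L → ℕ}
    (h : ∀ l, q l ≤ q' l) : softWorkload grp θ q ≤ softWorkload grp θ q' := by
  refine Finset.sum_le_sum fun g _ => ?_
  gcongr
  · exact expSum_pos hgrp ..
  · exact expSum_mono hθ h g

lemma softWorkload_add_le (hgrp : Function.Surjective grp) (hθ : 0 < θ) (q a : L → ℕ) :
    softWorkload grp θ (fun l => q l + a l) ≤ softWorkload grp θ q +
      ∑ l, softWeight grp θ q l * a l +
      Fintype.card G * min (∑ l, (a l : ℝ)) (θ * (∑ l, (a l : ℝ)) ^ 2) := by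
  set b := ∑ l, (a l : ℝ)
  calc softWorkload grp θ (fun l => q l + a l)
      ≤ ∑ g, (θ⁻¹ * Real.log (expSum grp θ q g) +
          ∑ l with grp l = g, softWeight grp θ q l * a l + min b (θ * b ^ 2)) := by
        refine Finset.sum_le_sum fun g _ => ?_
        calc _ ≤ θ⁻¹ * (Real.log (expSum grp θ q g) +
              (∑ l with grp l = g, softWeight grp θ q l * (θ * a l) +
                min (θ * b) ((θ * b) ^ 2))) := by
              gcongr
              exact log_expSum_add_le hgrp hθ.le q a g
          _ = _ := by
              have h1 : min (θ * b) ((θ * b) ^ 2) = θ * min b (θ * b ^ 2) := by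
                rw [mul_min_of_nonneg _ _ hθ.le]; ring_nf
              have h2 : ∑ l with grp l = g, softWeight grp θ q l * (θ * a l) =
                  θ * ∑ l with grp l = g, softWeight grp θ q l * a l := by
                rw [Finset.mul_sum]; exact Finset.sum_congr rfl fun l _ => by ring
              rw [h1, h2]
              field_simp
              ring
    _ = _ := by
        rw [Finset.sum_add_distrib, Finset.sum_add_distrib,
          Finset.sum_fiberwise (s := Finset.univ) (g := grp)
            (f := fun l => softWeight grp θ q l * (a l : ℝ))]
        simp [softWorkload]

lemma softWorkload_served_le (hgrp : Function.Surjective grp) (hθ : 0 < θ) {q q' : L → ℕ} (l₀ : L)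
    (h : ∀ l, q' l = q l - if grp l = grp l₀ then 1 else 0) :
    softWorkload grp θ q' + 1 ≤ softWorkload grp θ q +
      θ⁻¹ * (Fintype.card L * Real.exp θ * Real.exp (-(θ * q l₀))) := by
  have h1 : softWorkload grp θ q' ≤ ∑ g, (θ⁻¹ * Real.log (expSum grp θ q g) +
      if grp l₀ = g then θ⁻¹ * (-θ + Fintype.card L * Real.exp θ * Real.exp (-(θ * q l₀)))
        else 0) := by
    refine Finset.sum_le_sum fun g _ => ?_
    split_ifs with hg
    · subst hg
      rw [← mul_add]
      gcongr
      have := log_expSum_served_le hgrp (θ := θ) (q := q) (q' := q') l₀ fun l hl => by rw [h, if_pos hl]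
      linarith
    · rw [add_zero]
      gcongr
      · exact expSum_pos hgrp ..
      · exact expSum_mono hθ.le (fun l => (h l).trans_le (Nat.sub_le _ _)) g
  rw [Finset.sum_add_distrib, Finset.sum_ite_eq] at h1
  simp only [Finset.mem_univ, if_true, mul_add, mul_neg, inv_mul_cancel₀ hθ.ne'] at h1
  have : ∑ g, θ⁻¹ * Real.log (expSum grp θ q g) = softWorkload grp θ q := rfl
  linarith

/-- The weights of a group average its rates, and an average is at most the maximum; this is the
gain from smoothing. -/
lemma sum_softWeight_mul_le (hgrp : Function.Surjective grp) (θ : ℝ) (q : L → ℕ) {lam : L → ℝ}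
    {ρ : G → ℝ} (hle : ∀ l, lam l ≤ ρ (grp l)) :
    ∑ l, softWeight grp θ q l * lam l ≤ ∑ g, ρ g := by
  rw [← Finset.sum_fiberwise (s := Finset.univ) (g := grp)]
  refine Finset.sum_le_sum fun g _ => ?_
  calc _ ≤ ∑ l with grp l = g, softWeight grp θ q l * ρ g := by
        refine Finset.sum_le_sum fun l hl => ?_
        obtain rfl : grp l = g := by simpa using hl
        exact mul_le_mul_of_nonneg_left (hle l) (softWeight_nonneg hgrp ..)
    _ = ρ g := by rw [← Finset.sum_mul, sum_softWeight hgrp, one_mul]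

/-- The mean increase of the smoothed workload by the arrivals of a slot. -/
lemma tsum_softWorkload_add_le (hgrp : Function.Surjective grp) (hθ : 0 < θ) (ν : PMF (L → ℕ))
    {lam : L → ℝ} {ρ : G → ℝ} (hlam : ∀ l, 0 ≤ lam l) (hle : ∀ l, lam l ≤ ρ (grp l))
    (hmean : ∀ l, ∑' a, ν a * (a l : ℝ≥0∞) = ENNReal.ofReal (lam l)) {η : ℝ} (hη : 0 ≤ η)
    (herr : Fintype.card G * ∑' a, ν a * ENNReal.ofReal
      (min (∑ l, (a l : ℝ)) (θ * (∑ l, (a l : ℝ)) ^ 2)) ≤ ENNReal.ofReal η) (q : L → ℕ) :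
    ∑' a, ν a * ENNReal.ofReal (softWorkload grp θ fun l => q l + a l) ≤
      ENNReal.ofReal (softWorkload grp θ q + ∑ g, ρ g + η) := by
  have hV := softWorkload_nonneg hgrp hθ.le q
  have hw := softWeight_nonneg hgrp θ q
  have hwl : 0 ≤ ∑ l, softWeight grp θ q l * lam l :=
    Finset.sum_nonneg fun l _ => mul_nonneg (hw l) (hlam l)
  have hpt (a : L → ℕ) : ENNReal.ofReal (softWorkload grp θ fun l => q l + a l) ≤
      ENNReal.ofReal (softWorkload grp θ q) +
        ∑ l, ENNReal.ofReal (softWeight grp θ q l) * (a l : ℝ≥0∞) +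
      Fintype.card G * ENNReal.ofReal
        (min (∑ l, (a l : ℝ)) (θ * (∑ l, (a l : ℝ)) ^ 2)) := by
    refine (ENNReal.ofReal_le_ofReal (softWorkload_add_le hgrp hθ q a)).trans
      (ENNReal.ofReal_add_le.trans (add_le_add (ENNReal.ofReal_add_le.trans ?_) ?_))
    · gcongr
      rw [ENNReal.ofReal_sum_of_nonneg fun l _ => mul_nonneg (hw l) (by positivity)]
      refine Finset.sum_le_sum fun l _ => ?_
      rw [ENNReal.ofReal_mul (hw l), ENNReal.ofReal_natCast]
    · rw [ENNReal.ofReal_mul (by positivity), ENNReal.ofReal_natCast]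
  calc _ ≤ ∑' a, (ν a * ENNReal.ofReal (softWorkload grp θ q) +
        ∑ l, ENNReal.ofReal (softWeight grp θ q l) * (ν a * (a l : ℝ≥0∞)) +
        Fintype.card G * (ν a * ENNReal.ofReal
          (min (∑ l, (a l : ℝ)) (θ * (∑ l, (a l : ℝ)) ^ 2)))) := by
        refine ENNReal.tsum_le_tsum fun a => (mul_le_mul_right (hpt a) _).trans_eq ?_
        rw [mul_add, mul_add, Finset.mul_sum, mul_left_comm (ν a) (Fintype.card G : ℝ≥0∞)]
        simp only [mul_left_comm (ν a)]
    _ = ENNReal.ofReal (softWorkload grp θ q) +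
        ∑ l, ENNReal.ofReal (softWeight grp θ q l) * ENNReal.ofReal (lam l) +
        Fintype.card G * ∑' a, ν a * ENNReal.ofReal
          (min (∑ l, (a l : ℝ)) (θ * (∑ l, (a l : ℝ)) ^ 2)) := by
        rw [ENNReal.tsum_add, ENNReal.tsum_add, ENNReal.tsum_mul_right, PMF.tsum_coe, one_mul,
          ENNReal.tsum_mul_left, Summable.tsum_finsetSum fun _ _ => ENNReal.summable]
        simp only [ENNReal.tsum_mul_left, hmean]
    _ ≤ ENNReal.ofReal (softWorkload grp θ q) +
        ENNReal.ofReal (∑ l, softWeight grp θ q l * lam l) + ENNReal.ofReal η := by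
        rw [ENNReal.ofReal_sum_of_nonneg fun l _ => mul_nonneg (hw l) (hlam l)]
        simp only [ENNReal.ofReal_mul (hw _)]
        gcongr
    _ ≤ _ := by
        rw [← ENNReal.ofReal_add hV hwl, ← ENNReal.ofReal_add (by positivity) hη]
        have := sum_softWeight_mul_le hgrp θ q hle
        exact ENNReal.ofReal_le_ofReal (by linarith)

lemma exists_smoothing {ν : PMF (L → ℕ)} {lam : L → ℝ}
    (hmean : ∀ l, ∑' a, ν a * (a l : ℝ≥0∞) = ENNReal.ofReal (lam l)) (G : Type*) [Fintype G]
    {η : ℝ} (hη : 0 < η) : ∃ θ : ℝ, 0 < θ ∧ Fintype.card G * ∑' a, ν a * ENNReal.ofReal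
      (min (∑ l, (a l : ℝ)) (θ * (∑ l, (a l : ℝ)) ^ 2)) ≤ ENNReal.ofReal η := by
  have hfin : ∑' a, ν a * ENNReal.ofReal (∑ l, (a l : ℝ)) ≠ ∞ := by
    have (a : L → ℕ) : ν a * ENNReal.ofReal (∑ l, (a l : ℝ)) = ∑ l, ν a * (a l : ℝ≥0∞) := by
      rw [ENNReal.ofReal_sum_of_nonneg fun l _ => by positivity, Finset.mul_sum]
      simp only [ENNReal.ofReal_natCast]
    simp only [this]
    rw [Summable.tsum_finsetSum fun _ _ => ENNReal.summable]
    simp [hmean]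
  have h1 := ENNReal.Tendsto.const_mul (a := (Fintype.card G : ℝ≥0∞))
    (tendsto_tsum_min ν (f := fun a => ∑ l, (a l : ℝ)) (fun a => by positivity) hfin)
    (.inr (ENNReal.natCast_ne_top _))
  rw [mul_zero] at h1
  have h2 := h1.eventually_le_const (u := ENNReal.ofReal η) (by simpa using hη)
  obtain ⟨θ, h3, h4⟩ := (h2.and self_mem_nhdsWithin).exists
  exact ⟨θ, h4, h3⟩

/-- A chain that, in every state, serves the group of a longest queue and has arrivals that are
independent over slots is positive recurrent, when the rates of the groups, that is, the largest
rates of their links, sum to less than one. -/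
theorem positiveRecurrent_of_longest [Nonempty L] (hgrp : Function.Surjective grp)
    {ν : PMF (L → ℕ)} {P : (L → ℕ) → PMF (L → ℕ)} {lam : L → ℝ} {ρ : G → ℝ}
    (hlam : ∀ l, 0 ≤ lam l) (hle : ∀ l, lam l ≤ ρ (grp l)) (hρ : ∑ g, ρ g < 1)
    (hmean : ∀ l, ∑' a, ν a * (a l : ℝ≥0∞) = ENNReal.ofReal (lam l))
    (hP : ∀ (q : L → ℕ) (W : (L → ℕ) → ℝ≥0∞) (c : ℝ≥0∞),
      (∀ s : L, (∀ l, q l ≤ q s) →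
        ∑' a, ν a * W (fun l => q l + a l - if grp l = grp s then 1 else 0) ≤ c) →
      ∑' q', P q q' * W q' ≤ c) :
    PositiveRecurrent P := by
  classical
  -- The slack is split in three: smoothing error of the arrivals, service lost on empty queues, and
  -- the remaining drift.
  obtain ⟨η, hη, hη1⟩ : ∃ η > 0, ∑ g, ρ g + 3 * η = 1 :=
    ⟨(1 - ∑ g, ρ g) / 3, by linarith, by ring⟩
  obtain ⟨θ, hθ, herr⟩ := exists_smoothing hmean G hη
  obtain ⟨K, hK⟩ : ∃ K : ℕ,
      θ⁻¹ * (Fintype.card L * Real.exp θ * Real.exp (-(θ * K))) ≤ η := by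
    have h1 : Tendsto (fun K : ℕ => Real.exp (-(θ * K))) atTop (𝓝 0) :=
      Real.tendsto_exp_neg_atTop_nhds_zero.comp
        (tendsto_natCast_atTop_atTop.const_mul_atTop hθ)
    have h2 := (h1.const_mul (Fintype.card L * Real.exp θ)).const_mul θ⁻¹
    rw [mul_zero, mul_zero] at h2
    exact (h2.eventually_le_const hη).exists
  set V : (L → ℕ) → ℝ≥0∞ := fun q => ENNReal.ofReal (softWorkload grp θ q) with hV
  have harr := tsum_softWorkload_add_le hgrp hθ ν hlam hle hmean hη.le herr
  have hfin (q : L → ℕ) : ∑' q', P q q' * V q' ≠ ∞ := by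
    refine ((hP q V _ fun s _ => ?_).trans_lt (ENNReal.ofReal_lt_top
      (r := softWorkload grp θ q + ∑ g, ρ g + η))).ne
    refine le_trans (ENNReal.tsum_le_tsum fun a => ?_) (harr q)
    refine mul_le_mul_right (ENNReal.ofReal_le_ofReal ?_) _
    exact softWorkload_mono hgrp hθ.le fun l => Nat.sub_le _ _
  refine positiveRecurrent_of_finite P (Set.finite_Iic fun _ : L => K)
    (meanHit_lt_top_of_drift P (V := V) (η := ENNReal.ofReal η) (by simpa using hη)
      ENNReal.ofReal_ne_top hfin fun q hq => ?_)
  -- The unit of service stays on the left as `+ 1`, since subtraction in `ℝ≥0∞` truncates.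
  have hserved (s : L) (hs : ∀ l, q l ≤ q s) :
      ∑' a, ν a * V (fun l => q l + a l - if grp l = grp s then 1 else 0) + 1 ≤
        ENNReal.ofReal (softWorkload grp θ q + (1 - η)) := by
    have hKs : K ≤ q s := by
      by_contra! hlt
      exact hq fun l => (hs l).trans hlt.le
    have hpt (a : L → ℕ) : V (fun l => q l + a l - if grp l = grp s then 1 else 0) + 1 ≤
        ENNReal.ofReal (softWorkload grp θ fun l => q l + a l) + ENNReal.ofReal η := by
      rw [hV, ← ENNReal.ofReal_one, ← ENNReal.ofReal_add (softWorkload_nonneg hgrp hθ.le _)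
        zero_le_one, ← ENNReal.ofReal_add (softWorkload_nonneg hgrp hθ.le _) hη.le]
      refine ENNReal.ofReal_le_ofReal ((softWorkload_served_le hgrp hθ
        (q := fun l => q l + a l) s fun l => rfl).trans ?_)
      gcongr
      refine le_trans ?_ hK
      gcongr
      exact_mod_cast hKs.trans (Nat.le_add_right _ _)
    calc _ = ∑' a, ν a * (V (fun l => q l + a l - if grp l = grp s then 1 else 0) + 1) := by
          simp only [mul_add, mul_one, ENNReal.tsum_add, PMF.tsum_coe]
      _ ≤ ∑' a, ν a * (ENNReal.ofReal (softWorkload grp θ fun l => q l + a l) +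
            ENNReal.ofReal η) :=
          ENNReal.tsum_le_tsum fun a => mul_le_mul_right (hpt a) _
      _ = ∑' a, ν a * ENNReal.ofReal (softWorkload grp θ fun l => q l + a l) +
            ENNReal.ofReal η := by
          simp only [mul_add, ENNReal.tsum_add, ENNReal.tsum_mul_right, PMF.tsum_coe, one_mul]
      _ ≤ ENNReal.ofReal (softWorkload grp θ q + ∑ g, ρ g + η) + ENNReal.ofReal η := by
          gcongr
          exact harr q
      _ = _ := by
          have hρ0 : 0 ≤ ∑ g, ρ g := Finset.sum_nonneg fun g _ => by
            obtain ⟨l, rfl⟩ := hgrp g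
            exact (hlam l).trans (hle l)
          have hV0 := softWorkload_nonneg hgrp hθ.le q
          rw [← ENNReal.ofReal_add (by positivity) hη.le]
          congr 1
          linarith
  -- This makes `softWorkload - η` a nonnegative real; it follows from `hserved`, whose left side is
  -- at least one.
  have hηV : η ≤ softWorkload grp θ q := by
    obtain ⟨s, hs⟩ := Finite.exists_max q
    have h1 := le_add_self.trans (hserved s hs)
    rw [ENNReal.one_le_ofReal] at h1
    linarith
  have hc : V q =
      ENNReal.ofReal (softWorkload grp θ q - η) + ENNReal.ofReal η := by
    rw [← ENNReal.ofReal_add (by linarith) hη.le, sub_add_cancel]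
  rw [hc]
  gcongr
  refine hP q V _ fun s hs => ?_
  have h1 := hserved s hs
  have h2 : softWorkload grp θ q + (1 - η) = (softWorkload grp θ q - η) + 1 := by ring
  rw [h2, ENNReal.ofReal_add (by linarith) zero_le_one, ENNReal.ofReal_one] at h1
  exact (ENNReal.add_le_add_iff_right ENNReal.one_ne_top).1 h1

end Lyapunov
-- Longest queues of the groups
section Grouped

variable {L G : Type*} [Fintype L] [DecidableEq G] (grp : L → G)

/-- The longest queue in the group `g` of links. -/
def groupMax (q : L → ℕ) (g : G) : ℕ :=
  (Finset.univ.filter fun l => grp l = g).sup q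

/-- The sum of the longest queues of the groups. -/
def workload [Fintype G] (q : L → ℕ) : ℕ := ∑ g, groupMax grp q g

variable {grp}

lemma le_groupMax (q : L → ℕ) (l : L) : q l ≤ groupMax grp q (grp l) :=
  Finset.le_sup (f := q) (by simp)

lemma groupMax_le {q : L → ℕ} {g : G} {n : ℕ} (h : ∀ l, grp l = g → q l ≤ n) :
    groupMax grp q g ≤ n :=
  Finset.sup_le fun l hl => h l (by simpa using hl)

lemma le_workload [Fintype G] (q : L → ℕ) (l : L) : q l ≤ workload grp q :=
  (le_groupMax q l).trans (Finset.single_le_sum (f := groupMax grp q) (by simp) (by simp))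

lemma exists_groupMax_eq (hgrp : Function.Surjective grp) (q : L → ℕ) (g : G) :
    ∃ l, grp l = g ∧ groupMax grp q g = q l := by
  obtain ⟨l, hl, h⟩ := Finset.exists_mem_eq_sup (Finset.univ.filter fun l => grp l = g)
    (by obtain ⟨l, hl⟩ := hgrp g; exact ⟨l, by simpa using hl⟩) q
  exact ⟨l, by simpa using hl, h⟩

lemma workload_le [Fintype G] {q : L → ℕ} {l : L} (h : ∀ l', q l' ≤ q l) :
    workload grp q ≤ Fintype.card G * q l := by
  calc _ ≤ ∑ _g : G, q l := Finset.sum_le_sum fun g _ => groupMax_le fun l' _ => h l'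
    _ = _ := by simp

end Grouped

/-! ### Cumulative arrivals -/

/-- If `S t / t → c`, then the deviations `S t - c t` up to time `T` are uniformly `o(T)`. -/
lemma eventually_forall_abs_sub_le {S : ℕ → ℝ} {c : ℝ}
    (h : Tendsto (fun T : ℕ => S T / T) atTop (𝓝 c)) {ε : ℝ} (hε : 0 < ε) :
    ∀ᶠ T : ℕ in atTop, ∀ t ≤ T, |S t - c * t| ≤ ε * T := by
  have h1 : ∀ᶠ t : ℕ in atTop, |S t - c * t| ≤ ε * t := by
    filter_upwards [Metric.tendsto_nhds.1 h ε hε, eventually_gt_atTop 0] with t ht ht0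
    have ht0 : (0 : ℝ) < t := by exact_mod_cast ht0
    rw [Real.dist_eq] at ht
    have : S t - c * t = (S t / t - c) * t := by field_simp
    rw [this, abs_mul, abs_of_pos ht0]
    gcongr
  obtain ⟨t₀, ht₀⟩ := eventually_atTop.1 h1
  obtain ⟨C, hC⟩ := ((Finset.range t₀).image fun t : ℕ => |S t - c * t|).bddAbove
  have h2 : ∀ᶠ T : ℕ in atTop, C ≤ ε * T :=
    (tendsto_natCast_atTop_atTop.const_mul_atTop hε).eventually_ge_atTop C
  filter_upwards [h2] with T hT t ht
  rcases lt_or_ge t t₀ with h | h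
  · exact (hC (by simpa using ⟨t, h, rfl⟩)).trans hT
  · exact (ht₀ t h).trans (by gcongr)

/-! ### Pathwise bounds when the group of a longest queue is served -/

section Trajectory

variable {L G : Type*} [DecidableEq G] {grp : L → G}
  {Q A : ℕ → L → ℕ} {s : ℕ → L}

/-- The number of slots before `t` in which the group `g` is served. -/
def serviceCount (grp : L → G) (s : ℕ → L) (g : G) (t : ℕ) : ℕ :=
  ∑ i ∈ Finset.range t, if grp (s i) = g then 1 else 0

lemma serviceCount_succ (g : G) (t : ℕ) :
    serviceCount grp s g (t + 1) = serviceCount grp s g t + if grp (s t) = g then 1 else 0 :=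
  Finset.sum_range_succ ..

lemma sum_serviceCount [Fintype G] (t : ℕ) : ∑ g, serviceCount grp s g t = t := by
  unfold serviceCount
  rw [Finset.sum_comm]
  simp

/-- A queue that has never been served while empty evolves linearly; otherwise it is bounded by
the arrivals minus the services after some slot in which its group was served. -/
lemma queue_le_or_exists
    (hstep : ∀ t l, Q (t + 1) l = Q t l + A t l - if grp l = grp (s t) then 1 else 0)
    (l : L) (t₀ t : ℕ) (ht : t₀ ≤ t) :
    ((Q t l : ℝ) ≤ Q t₀ l + (∑ i ∈ Finset.range t, (A i l : ℝ) - ∑ i ∈ Finset.range t₀, (A i l : ℝ))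
        - (serviceCount grp s (grp l) t - serviceCount grp s (grp l) t₀)) ∨
    ∃ w, t₀ ≤ w ∧ w < t ∧ grp (s w) = grp l ∧
      (Q t l : ℝ) ≤ 1 + (∑ i ∈ Finset.range t, (A i l : ℝ) - ∑ i ∈ Finset.range w, (A i l : ℝ))
        - (serviceCount grp s (grp l) t - serviceCount grp s (grp l) w) := by
  induction t, ht using Nat.le_induction with
  | base => left; simp
  | succ t ht ih =>
    have hs := hstep t l
    by_cases hserve : grp l = grp (s t)
    · rw [if_pos hserve] at hs
      rcases Nat.eq_zero_or_pos (Q t l + A t l) with h0 | h0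
      -- The service is wasted, so `w` is reset to `t`; the summand `1` in the bound offsets the
      -- service counted in slot `w` itself.
      · right
        refine ⟨t, ht, t.lt_succ_self, hserve.symm, ?_⟩
        rw [serviceCount_succ, if_pos hserve.symm, Finset.sum_range_succ, hs, h0]
        push_cast
        have : (0 : ℝ) ≤ A t l := by positivity
        linarith
      · have hs' : (Q (t + 1) l : ℝ) = Q t l + A t l - 1 := by
          rw [hs, Nat.cast_sub h0]; push_cast; ring
        rw [hs', serviceCount_succ, if_pos hserve.symm, Finset.sum_range_succ]
        push_cast
        rcases ih with h | ⟨w, h1, h2, h3, h4⟩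
        · left; linarith
        · exact .inr ⟨w, h1, h2.trans t.lt_succ_self, h3, by linarith⟩
    · rw [if_neg hserve] at hs
      have hs' : (Q (t + 1) l : ℝ) = Q t l + A t l := by
        rw [hs, Nat.sub_zero]; push_cast; ring
      rw [hs', serviceCount_succ, if_neg (fun h => hserve h.symm), Finset.sum_range_succ]
      push_cast
      rcases ih with h | ⟨w, h1, h2, h3, h4⟩
      · left; linarith
      · exact .inr ⟨w, h1, h2.trans t.lt_succ_self, h3, by linarith⟩

variable [Fintype L]

/-- While the longest queue exceeds `b + 1`, a queue that has been served while empty is no longer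
than its companion was. -/
lemma queue_le_of_busy
    (hstep : ∀ t l, Q (t + 1) l = Q t l + A t l - if grp l = grp (s t) then 1 else 0)
    {ρ : G → ℝ} {b : ℝ} {t₀ T : ℕ}
    (harr : ∀ l t t', t ≤ t' → t' ≤ T → ∑ i ∈ Finset.range t', (A i l : ℝ) -
      ∑ i ∈ Finset.range t, (A i l : ℝ) ≤ ρ (grp l) * (t' - t) + b)
    (hbusy : ∀ t, t₀ ≤ t → t < T → b + 1 ≤ Q t (s t)) (t : ℕ) (ht : t₀ ≤ t) (htT : t ≤ T) (l : L) :
    (Q t l : ℝ) ≤ groupMax grp (Q t₀) (grp l) + ρ (grp l) * (t - t₀)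
        - (serviceCount grp s (grp l) t - serviceCount grp s (grp l) t₀) + b := by
  induction t using Nat.strong_induction_on generalizing l with
  | _ t ih =>
    rcases queue_le_or_exists hstep l t₀ t ht with h | ⟨w, h1, h2, h3, h4⟩
    · have h1 := harr l t₀ t ht htT
      have h2 : (Q t₀ l : ℝ) ≤ groupMax grp (Q t₀) (grp l) := by
        exact_mod_cast le_groupMax (grp := grp) (Q t₀) l
      linarith
    -- The bound at time `w` is applied to the companion `s w`, whose length is at least `b + 1`.
    -- This cancels the `b` of the induction hypothesis and pays for the `1` in `h4`, so the error
    -- `b` does not accumulate.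
    · have h5 := ih w h2 h1 (h2.le.trans htT) (s w)
      rw [h3] at h5
      have h6 := hbusy w h1 (h2.trans_le htT)
      have h7 := harr l w t h2.le htT
      linarith

variable [Fintype G]

/-- A crude bound, needed only for the one slot in which the workload crosses the threshold. -/
lemma workload_succ_le
    (hstep : ∀ t l, Q (t + 1) l = Q t l + A t l - if grp l = grp (s t) then 1 else 0) (t : ℕ) :
    workload grp (Q (t + 1)) ≤ workload grp (Q t) + Fintype.card G * ∑ l, A t l := by
  calc workload grp (Q (t + 1)) ≤ ∑ g, (groupMax grp (Q t) g + ∑ l, A t l) := by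
        refine Finset.sum_le_sum fun g _ => groupMax_le fun l hl => ?_
        subst hl
        rw [hstep]
        have h1 := le_groupMax (grp := grp) (Q t) l
        have h2 := Finset.single_le_sum (f := A t) (fun _ _ => Nat.zero_le _) (Finset.mem_univ l)
        omega
    _ = _ := by simp [Finset.sum_add_distrib, workload]

/-- If, in every slot, the group of a longest queue is served, and the rates of the groups, that is,
the largest rates of their links, sum to at most one, then the queues are rate stable. -/
theorem tendsto_queue_div (hgrp : Function.Surjective grp)
    (hstep : ∀ t l, Q (t + 1) l = Q t l + A t l - if grp l = grp (s t) then 1 else 0)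
    (hlong : ∀ t l, Q t l ≤ Q t (s t)) {lam : L → ℝ} {ρ : G → ℝ} (hle : ∀ l, lam l ≤ ρ (grp l))
    (hρ : ∑ g, ρ g ≤ 1)
    (hrate : ∀ l, Tendsto (fun T : ℕ => (∑ t ∈ Finset.range T, (A t l : ℝ)) / T) atTop
      (𝓝 (lam l))) (l : L) :
    Tendsto (fun T : ℕ => (Q T l : ℝ) / T) atTop (𝓝 0) := by
  have hG : (0 : ℝ) < Fintype.card G := by exact_mod_cast Fintype.card_pos_iff.2 ⟨grp l⟩
  have hL : (0 : ℝ) < Fintype.card L := by exact_mod_cast Fintype.card_pos_iff.2 ⟨l⟩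
  set n : ℝ := (Fintype.card G : ℝ) with hn
  set k : ℝ := (Fintype.card L : ℝ) with hk
  suffices hmain : ∀ δ > 0, ∀ᶠ T : ℕ in atTop, (workload grp (Q T) : ℝ) ≤ δ * T by
    rw [Metric.tendsto_nhds]
    intro δ hδ
    filter_upwards [hmain (δ / 2) (by positivity), eventually_gt_atTop 0] with T hT hT0
    have hT0 : (0 : ℝ) < T := by exact_mod_cast hT0
    have h1 : (Q T l : ℝ) ≤ workload grp (Q T) := by exact_mod_cast le_workload (Q T) l
    rw [Real.dist_eq, sub_zero, abs_of_nonneg (by positivity), div_lt_iff₀ hT0]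
    nlinarith
  intro δ hδ
  -- the deviations of the arrivals are at most `ε T`
  obtain ⟨ε, hε, hε1, hε2⟩ : ∃ ε > 0, 3 * n * ε ≤ δ / 2 ∧ n * k * (3 * ε) + 2 * n * ε ≤ δ / 2 := by
    refine ⟨δ / 2 / (3 * n + n * k * 3 + 2 * n), by positivity, ?_, ?_⟩ <;>
    · rw [← sub_nonneg]
      have : 0 < 3 * n + n * k * 3 + 2 * n := by positivity
      field_simp
      ring_nf
      positivity
  have hdev := eventually_all.2 fun l => eventually_forall_abs_sub_le (hrate l) hε
  have hbig (C : ℝ) {ε : ℝ} (hε : 0 < ε) : ∀ᶠ T : ℕ in atTop, C ≤ ε * T :=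
    (tendsto_natCast_atTop_atTop.const_mul_atTop hε).eventually_ge_atTop C
  filter_upwards [hdev, hbig 1 hε, eventually_all.2 fun l => hbig (lam l) hε,
    hbig (workload grp (Q 0)) (half_pos hδ)] with T hdev h1 hlam h0
  by_cases hcase : (workload grp (Q T) : ℝ) ≤ δ / 2 * T
  · exact hcase.trans (by gcongr; linarith)
  -- the last slot with a small workload
  classical
  let p : ℕ → Prop := fun t => (workload grp (Q t) : ℝ) ≤ δ / 2 * T
  set t₁ := Nat.findGreatest p T with ht₁
  have hp₁ : p t₁ := Nat.findGreatest_spec (P := p) (Nat.zero_le T) h0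
  have ht₁T : t₁ < T := lt_of_le_of_ne (Nat.findGreatest_le T) fun h => by
    rw [h] at hp₁; exact hcase hp₁
  have hlarge (t : ℕ) (h : t₁ < t) (h' : t ≤ T) : δ / 2 * T < workload grp (Q t) :=
    not_le.1 (Nat.findGreatest_is_greatest h h')
  have harr (l : L) (t t' : ℕ) (htt' : t ≤ t') (ht' : t' ≤ T) : ∑ i ∈ Finset.range t', (A i l : ℝ) -
      ∑ i ∈ Finset.range t, (A i l : ℝ) ≤ lam l * (t' - t) + 2 * ε * T := by
    have h1 := abs_le.1 (hdev l t (htt'.trans ht'))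
    have h2 := abs_le.1 (hdev l t' ht')
    linarith
  -- A workload above `δ / 2 * T ≥ 3 * n * ε * T` forces a queue of length `3 * ε * T`, and `1 ≤ ε *
  -- T`. The busy period starts at `t₁ + 1`, since the workload is still small at `t₁`.
  have hbusy (t : ℕ) (ht : t₁ + 1 ≤ t) (htT : t < T) : 2 * ε * T + 1 ≤ (Q t (s t) : ℝ) := by
    have h2 := hlarge t ht htT.le
    have h3 : (workload grp (Q t) : ℝ) ≤ n * Q t (s t) := by
      rw [hn]
      exact_mod_cast workload_le (grp := grp) (hlong t)
    have h4 : n * (3 * ε * T) ≤ n * Q t (s t) := by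
      calc n * (3 * ε * T) = 3 * n * ε * T := by ring
        _ ≤ δ / 2 * T := by gcongr
        _ ≤ _ := by linarith
    have h5 := le_of_mul_le_mul_left h4 hG
    linarith
  have hq := queue_le_of_busy hstep (ρ := ρ) (b := 2 * ε * T) (t₀ := t₁ + 1) (T := T)
    (fun l t t' htt' ht' => (harr l t t' htt' ht').trans (by
      have : (t : ℝ) ≤ t' := by exact_mod_cast htt'
      have := mul_le_mul_of_nonneg_right (hle l) (sub_nonneg.2 this)
      linarith)) hbusy T ht₁T le_rfl
  -- In a single slot each link receives at most `lam l + 2 * ε * T ≤ 3 * ε * T`.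
  have hjump : (workload grp (Q (t₁ + 1)) : ℝ) ≤ δ / 2 * T + n * (k * (3 * ε * T)) := by
    have h2 : (workload grp (Q (t₁ + 1)) : ℝ) ≤ workload grp (Q t₁) + n * ∑ l, (A t₁ l : ℝ) := by
      rw [hn]
      exact_mod_cast workload_succ_le hstep t₁
    have h3 : ∑ l, (A t₁ l : ℝ) ≤ k * (3 * ε * T) := by
      calc ∑ l, (A t₁ l : ℝ) ≤ ∑ l : L, 3 * ε * T := by
            refine Finset.sum_le_sum fun l _ => ?_
            have h4 := harr l t₁ (t₁ + 1) t₁.le_succ ht₁T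
            rw [Finset.sum_range_succ] at h4
            push_cast at h4
            have := hlam l
            linarith
        _ = _ := by simp [hk]
    have h4 : n * ∑ l, (A t₁ l : ℝ) ≤ n * (k * (3 * ε * T)) := by gcongr
    have h5 : (workload grp (Q t₁) : ℝ) ≤ δ / 2 * T := hp₁
    linarith
  have hT1 : ((t₁ + 1 : ℕ) : ℝ) ≤ T := by exact_mod_cast ht₁T
  have hfinal : (workload grp (Q T) : ℝ) ≤ workload grp (Q (t₁ + 1)) + n * (2 * ε * T) := by
    calc (workload grp (Q T) : ℝ) = ∑ g, (groupMax grp (Q T) g : ℝ) := by simp [workload]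
      _ ≤ ∑ g, ((groupMax grp (Q (t₁ + 1)) g : ℝ) + ρ g * (T - (t₁ + 1 : ℕ))
            - (serviceCount grp s g T - serviceCount grp s g (t₁ + 1)) + 2 * ε * T) := by
          refine Finset.sum_le_sum fun g _ => ?_
          obtain ⟨l, rfl, hl⟩ := exists_groupMax_eq hgrp (Q T) g
          rw [hl]
          exact hq l
      _ = workload grp (Q (t₁ + 1)) + (∑ g, ρ g) * (T - (t₁ + 1 : ℕ))
            - (T - (t₁ + 1 : ℕ)) + n * (2 * ε * T) := by
          have h2 (t : ℕ) : ∑ g, (serviceCount grp s g t : ℝ) = t := by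
            exact_mod_cast sum_serviceCount (grp := grp) (s := s) t
          rw [Finset.sum_add_distrib, Finset.sum_sub_distrib, Finset.sum_add_distrib,
            Finset.sum_sub_distrib, h2, h2, ← Finset.sum_mul]
          simp [workload, hn]
      -- As `∑ ρ ≤ 1`, the arrivals at the group rates do not exceed the one service per slot.
      _ ≤ _ := by nlinarith
  have : (n * k * (3 * ε) + 2 * n * ε) * T ≤ δ / 2 * T := by gcongr
  linarith

end Trajectory
-- Application to GMS in the collocated network
section Network

variable {NF NH : ℕ}

/-- Links of the same group are activated together: a full-duplex user forms one group, and each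
link of a half-duplex user is a group of its own. -/
def linkGroup : Link NF NH → Fin NF ⊕ (Fin NH × Dir)
  | (Sum.inl i, _) => Sum.inl i
  | (Sum.inr i, j) => Sum.inr (i, j)

lemma linkGroup_surjective : Function.Surjective (linkGroup (NF := NF) (NH := NH))
  | Sum.inl i => ⟨(Sum.inl i, Dir.ul), rfl⟩
  | Sum.inr (i, j) => ⟨(Sum.inr i, j), rfl⟩

lemma mem_activate {l l' : Link NF NH} : l' ∈ activate l ↔ linkGroup l' = linkGroup l := by
  rcases l with ⟨i | i, d⟩ <;> rcases l' with ⟨i' | i', d'⟩ <;> cases d' <;>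
    simp [activate, linkGroup]

lemma feasible_activate (l : Link NF NH) : Feasible (activate l) := by
  rcases l with ⟨i | i, d⟩
  · exact .pair i
  · exact .single _

lemma Feasible.linkGroup_eq {X : Schedule NF NH} (h : Feasible X) {l l' : Link NF NH}
    (hl : l ∈ X) (hl' : l' ∈ X) : linkGroup l = linkGroup l' := by
  cases h with
  | idle => simp at hl
  | single l₀ => simp_all
  | pair i =>
    simp only [Finset.mem_insert, Finset.mem_singleton] at hl hl'
    rcases hl with rfl | rfl <;> rcases hl' with rfl | rfl <;> rfl

/-- The sum is linear in `v` and counts the active representatives; the active links of a feasible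
schedule share a group, so at most one is counted, and the bound passes to the convex hull. -/
lemma sum_le_one_of_mem_capacityRegion {v : Link NF NH → ℝ} (hv : v ∈ capacityRegion NF NH)
    {c : Fin NF ⊕ (Fin NH × Dir) → Link NF NH} (hc : ∀ g, linkGroup (c g) = g) :
    ∑ g, v (c g) ≤ 1 := by
  have hconv : Convex ℝ {v : Link NF NH → ℝ | ∑ g, v (c g) ≤ 1} :=
    convex_halfSpace_le ⟨fun v w => by simp [Finset.sum_add_distrib],
      fun r v => (Finset.mul_sum ..).symm⟩ 1
  refine convexHull_min ?_ hconv hv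
  rintro _ ⟨X, hX, rfl⟩
  simp only [schedVec, Set.mem_ofPred_eq, Finset.sum_boole, Nat.cast_le_one]
  refine Finset.card_le_one.2 fun g hg g' hg' => ?_
  rw [← hc g, ← hc g']
  exact hX.linkGroup_eq (by simpa using hg) (by simpa using hg')

lemma nonneg_of_mem_capacityRegion {v : Link NF NH → ℝ} (hv : v ∈ capacityRegion NF NH)
    (l : Link NF NH) : 0 ≤ v l := by
  have hconv : Convex ℝ {v : Link NF NH → ℝ | 0 ≤ v l} :=
    convex_halfSpace_ge ⟨fun v w => rfl, fun r v => rfl⟩ 0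
  refine convexHull_min ?_ hconv hv
  rintro _ ⟨X, -, rfl⟩
  simp only [schedVec, Set.mem_ofPred_eq]
  split_ifs <;> simp

/-- All rates can be raised by a small `r > 0` within the region, which leaves room below one;
without groups the sum is zero. -/
lemma sum_lt_one_of_mem_interior {v : Link NF NH → ℝ} (hv : v ∈ interior (capacityRegion NF NH))
    {c : Fin NF ⊕ (Fin NH × Dir) → Link NF NH} (hc : ∀ g, linkGroup (c g) = g) :
    ∑ g, v (c g) < 1 := by
  have hcont : Continuous fun (r : ℝ) (l : Link NF NH) => v l + r := by fun_prop
  have h0 : ∀ᶠ r in 𝓝 (0 : ℝ), (fun l => v l + r) ∈ capacityRegion NF NH := by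
    refine hcont.continuousAt.eventually_mem ?_
    simpa using mem_interior_iff_mem_nhds.1 hv
  obtain ⟨r, hr, hr0⟩ := ((h0.filter_mono (nhdsWithin_le_nhds (s := Set.Ioi 0))).and
    self_mem_nhdsWithin).exists
  have hr0 : 0 < r := hr0
  have h1 := sum_le_one_of_mem_capacityRegion hr hc
  rw [Finset.sum_add_distrib] at h1
  simp only [Finset.sum_const, nsmul_eq_mul] at h1
  rcases isEmpty_or_nonempty (Fin NF ⊕ (Fin NH × Dir)) with hE | hE
  · simp
  · have : (0 : ℝ) < (Finset.univ : Finset (Fin NF ⊕ (Fin NH × Dir))).card := by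
      exact_mod_cast Finset.univ_nonempty.card_pos
    have := mul_pos this hr0
    linarith

/-- The rate of a group is the largest rate of its links; in the interior of the capacity region,
these rates sum to less than one. -/
lemma exists_groupRate {v : Link NF NH → ℝ} (hv : v ∈ interior (capacityRegion NF NH)) :
    ∃ ρ : Fin NF ⊕ (Fin NH × Dir) → ℝ, (∀ l, v l ≤ ρ (linkGroup l)) ∧ ∑ g, ρ g < 1 := by
  have (g : Fin NF ⊕ (Fin NH × Dir)) :
      ∃ l, linkGroup l = g ∧ ∀ l', linkGroup l' = g → v l' ≤ v l := by
    obtain ⟨l, hl, h⟩ := Finset.exists_max_image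
      (Finset.univ.filter fun l : Link NF NH => linkGroup l = g) v
      (by obtain ⟨l, hl⟩ := linkGroup_surjective g; exact ⟨l, by simpa using hl⟩)
    exact ⟨l, by simpa using hl, fun l' hl' => h l' (by simpa using hl')⟩
  choose c hc hmax using this
  exact ⟨fun g => v (c g), fun l => hmax _ l rfl, sum_lt_one_of_mem_interior hv hc⟩

lemma exists_of_mem_support_gms {q : Queues NF NH} {X : Schedule NF NH}
    (hX : X ∈ (gms NF NH q).support) :
    (∃ l, (∀ l', q l' ≤ q l) ∧ X = activate l) ∨ (IsEmpty (Link NF NH) ∧ X = ∅) := by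
  unfold gms at hX
  split_ifs at hX with h
  · left
    rw [PMF.support_map, PMF.support_uniformOfFinset] at hX
    obtain ⟨l, hl, rfl⟩ := hX
    exact ⟨l, by simpa [longest] using hl, rfl⟩
  · right
    refine ⟨?_, by simpa using hX⟩
    by_contra hne
    rw [not_isEmpty_iff] at hne
    obtain ⟨l, hl⟩ := Finite.exists_max q
    exact h ⟨l, by simpa [longest] using hl⟩

lemma nextQueues_activate (q a : Queues NF NH) (s : Link NF NH) :
    nextQueues q a (activate s) =
      fun l => q l + a l - if linkGroup l = linkGroup s then 1 else 0 := by
  funext l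
  simp only [nextQueues, mem_activate]

/-- A bound valid for each schedule in the support survives averaging, so the law of the
tie-breaking is irrelevant. -/
lemma tsum_queueChain_le (π : Policy NF NH) (ν : PMF (Queues NF NH)) (q : Queues NF NH)
    (W : Queues NF NH → ℝ≥0∞) {c : ℝ≥0∞}
    (h : ∀ X ∈ (π q).support, ∑' a, ν a * W (nextQueues q a X) ≤ c) :
    ∑' q', queueChain π ν q q' * W q' ≤ c := by
  rw [queueChain, tsum_bind_mul]
  exact tsum_mul_le _ fun X hX => by rw [tsum_map_mul]; exact h X hX

theorem positiveRecurrent_gms {lam : Link NF NH → ℝ}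
    (hlam : lam ∈ interior (capacityRegion NF NH)) {ν : PMF (Queues NF NH)}
    (hmean : ∀ l, ∑' a, ν a * (a l : ℝ≥0∞) = ENNReal.ofReal (lam l)) :
    PositiveRecurrent (queueChain (gms NF NH) ν) := by
  rcases isEmpty_or_nonempty (Link NF NH) with hE | hE
  -- Without links there is a single state.
  · refine positiveRecurrent_of_finite _ (Set.toFinite Set.univ) fun x => ?_
    rw [meanHit_eq]
    simp [killedStep]
  · obtain ⟨ρ, hle, hρ⟩ := exists_groupRate hlam
    refine positiveRecurrent_of_longest linkGroup_surjective
      (nonneg_of_mem_capacityRegion (interior_subset hlam)) hle hρ hmean fun q W c h => ?_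
    refine tsum_queueChain_le _ ν q W fun X hX => ?_
    rcases exists_of_mem_support_gms hX with ⟨s, hs, rfl⟩ | ⟨hE', -⟩
    · simpa only [nextQueues_activate] using h s hs
    · exact absurd hE (not_nonempty_iff.2 hE')

variable {π : Policy NF NH} {Ω : Type u} {m : MeasurableSpace Ω} {μ : Measure Ω}
  {ℱ : Filtration ℕ m} {A : ℕ → Ω → Queues NF NH} {X : ℕ → Ω → Schedule NF NH}
  {Q : ℕ → Ω → Queues NF NH}

lemma IsRun.measurable_queue (h : IsRun π μ ℱ A X Q) (t : ℕ) (l : Link NF NH) :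
    Measurable[ℱ t] fun ω => Q t ω l := by
  induction t with
  | zero => exact h.initial l
  | succ t ih =>
    have hX : MeasurableSet[ℱ (t + 1)] {ω | l ∈ X t ω} := by
      have : {ω | l ∈ X t ω} = ⋃ x ∈ {x : Schedule NF NH | l ∈ x}, {ω | X t ω = x} := by
        ext ω; simp
      rw [this]
      exact MeasurableSet.biUnion (Set.to_countable _) fun x _ => h.schedules t x
    have hQ : Measurable[ℱ (t + 1)] fun ω => Q t ω l := ih.mono (ℱ.mono t.le_succ) le_rfl
    have hA := h.arrivals t l
    simp only [h.step, nextQueues]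
    exact (hQ.add hA).sub (Measurable.ite hX measurable_const measurable_const)

/-- Almost surely, the schedule of a slot has positive probability under the policy. -/
lemma IsRun.ae_mem_support (h : IsRun π μ ℱ A X Q) :
    ∀ᵐ ω ∂μ, ∀ t, X t ω ∈ (π (Q t ω)).support := by
  rw [ae_all_iff]
  intro t
  have hx (x : Schedule NF NH) : ∀ᵐ ω ∂μ, ¬(π (Q t ω) x = 0 ∧ X t ω = x) := by
    -- The event that the policy gives `x` probability zero is known at the beginning of slot `t`,
    -- so `law` applies to it and the integrand vanishes there.
    have hB : MeasurableSet[ℱ t] {ω | π (Q t ω) x = 0} := by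
      have hQ : @Measurable _ _ (ℱ t) _ fun ω => Q t ω :=
        @measurable_pi_lambda _ _ _ (ℱ t) _ _ fun l => h.measurable_queue t l
      exact hQ (Set.to_countable {q : Queues NF NH | π q x = 0}).measurableSet
    have h0 := h.law t x _ hB
    rw [setLIntegral_congr_fun (g := fun _ => 0) (ℱ.le t _ hB) (fun ω hω => hω),
      lintegral_zero] at h0
    rw [ae_iff]
    simp only [not_not]
    exact h0
  filter_upwards [ae_all_iff.2 hx] with ω hω
  rw [PMF.mem_support_iff]
  exact fun h0 => hω _ ⟨h0, rfl⟩

/-- Randomness matters only through null sets: almost every path is one along which the group of a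
longest queue is served in every slot, and `tendsto_queue_div` applies to it. -/
theorem rateStable_gms {lam : Link NF NH → ℝ} (hlam : lam ∈ interior (capacityRegion NF NH))
    (h : IsRun (gms NF NH) μ ℱ A X Q) (hrate : HasRate μ A lam) : RateStable μ Q := by
  obtain ⟨ρ, hle, hρ⟩ := exists_groupRate hlam
  filter_upwards [h.ae_mem_support, hrate] with ω hX hA l
  have hs (t : ℕ) : ∃ s, (∀ l', Q t ω l' ≤ Q t ω s) ∧ X t ω = activate s := by
    rcases exists_of_mem_support_gms (hX t) with hs | ⟨hE, -⟩
    · exact hs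
    · exact hE.elim l
  choose s hlong hact using hs
  exact tendsto_queue_div (Q := fun t => Q t ω) (A := fun t => A t ω) linkGroup_surjective
    (fun t l => by rw [h.step, hact, nextQueues_activate]) hlong hle hρ.le hA l

end Network

end HDFD

theorem mainTheorem2 (NF NH : ℕ) : HDFD.ThroughputOptimal.{u} (HDFD.gms NF NH) := by
  refine ⟨fun q X hX => ?_, fun lam hlam => ⟨fun ν hν => HDFD.positiveRecurrent_gms hlam hν,
    fun Ω m μ _ ℱ A X Q hrun hrate => HDFD.rateStable_gms hlam hrun hrate⟩⟩
  rcases HDFD.exists_of_mem_support_gms hX with ⟨l, -, rfl⟩ | ⟨-, rfl⟩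
  · exact HDFD.feasible_activate l
  · exact .idle
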